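/- Let $n\ge 1$ and $[n]=\{1,\dots,n\}$. A *price schedule* is a family of real numbers $p=(p_I)_{I\subseteq[n]}$ with $p_\emptyset=0$. Its *regions* are $$D_I=\Big\{x\in[0,1]^n : \sum_{i\in I}x_i-p_I\ \ge\ \sum_{j\in J}x_j-p_J\ \text{ for all } J\subseteq[n]\Big\},\qquad I\subseteq[n].$$ Let $\pi_I$ denote the projection onto the coordinates in $I$, and put $$\delta_n(I)=\operatorname{vol}_{|I|}\pi_I(D_I)-\frac1{n+1}\sum_{i\in I}\operatorname{vol}_{|I|-1}\pi_{I\setminus\{i\}}(\pi_I(D_I)).$$ The schedule $p$ is *submodular* if $p_{I\cup J}+p_{I\cap J}\le p_I+p_J$ for all $I,J\subseteq[n]$, and *normalized* if $p_I=\min\{p_J: J\supsetneq I\}$ whenever $I\ne[n]$ and $\operatorname{vol}_n D_I=0$. If $I,J$ are incomparable (neither contains the other) and $p_{I\cup J}+p_{I\cap J}=p_I+p_J$, then $I\cup J$ and $I\cap J$ are called *left tight*, and $I$ and $J$ are called *right tight*. A bundle is *tight* if it is left tight or right tight. For $0\le k\le n$ let $\mathcal I_{k,n}=\{I\subseteq[n]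 : |I|\le k\}\cup\{[n]\}$. The schedule $p$ is *critical* with respect to $\mathcal I_{k,n}$ if $\{I:\operatorname{vol}_n D_I>0\}=\mathcal I_{k,n}$ and $\delta_n(I)=0$ for every nonempty $I\in\mathcal I_{k,n}$. It is *symmetric* if $p_I=p_J$ for all $I,J\in\mathcal I_{k,n}$ with $|I|=|J|$. Let $k\in\{1,\dots,n\}$ be the largest number for which there is a normalized, submodular, symmetric price schedule that is critical with respect to $\mathcal I_{k,n}$. Such a schedule, for this $k$, is the price schedule of the *straight jacket auction* (SJA) for $n$ items. The selling candidate $\mathcal I_{n-1,n}$, which consists of all subsets of $[n]$, is *solvable* if there are real numbers $(q_I)_{I\subseteq[n]}$ with $q_\emptyset=0$ such that for all $I\subseteq[n]$: $q_I\ge0$; $q_I+q_{J\cap J'}\le q_J+q_{J'}$ for all $J,J'\subseteq[n]$ with $J\cup J'=I$; and $$\operatorname{vol}_{|I|}\Big\{x\in[0,1]^I : \sum_{j\in J}x_j\le q_J\ \text{ for all } J\subseteq I\Big\}=1-\frac{|I|}{n+1}.$$ **Proposition.** Suppose that $\mathcal I_{n-1,n}$ is solvable. Then an SJA price schedule for $n$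 items exists, and every SJA price schedule $p$ satisfies the following necessary critical-point conditions for all nonempty $I\subseteq[n]$: 1. if $I$ is not tight and $\operatorname{vol}_nD_I>0$, then $\delta_n(I)=0$; 2. if $I$ is not tight and $\operatorname{vol}_nD_I=0$, then $\delta_n(I)\ge0$; 3. if $I$ is left tight but not right tight, then $\delta_n(I)\ge0$; 4. if $I$ is right tight but not left tight and $\operatorname{vol}_nD_I>0$, then $\delta_n(I)\le0$. -/

import Mathlib

namespace Auction

open MeasureTheory Finset

/-- A price schedule for `n` items: one price for every bundle, the empty bundle being free. -/
def IsPriceSchedule {n : ℕ} (p : Finset (Fin n) → ℝ) : Prop :=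
  p ∅ = 0

/-- The region `D_I` of a price schedule: the valuations in the unit cube at which buying the
bundle `I` maximizes the utility `∑ i ∈ I, x i - p I` over all bundles. -/
def region {n : ℕ} (p : Finset (Fin n) → ℝ) (I : Finset (Fin n)) : Set (Fin n → ℝ) :=
  {x | (∀ i, x i ∈ Set.Icc (0 : ℝ) 1) ∧
    ∀ J : Finset (Fin n), ∑ j ∈ J, x j - p J ≤ ∑ i ∈ I, x i - p I}

/-- The `n`-dimensional volume of `D_I`. -/
noncomputable def regionVol {n : ℕ} (p : Finset (Fin n) → ℝ) (I : Finset (Fin n)) : ℝ :=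
  volume.real (region p I)

/-- The projection `π_I(D_I)` of the region `D_I` onto the coordinates in `I`. -/
def projRegion {n : ℕ} (p : Finset (Fin n) → ℝ) (I : Finset (Fin n)) : Set (I → ℝ) :=
  I.restrict '' region p I

/-- The projection of `π_I(D_I)` onto the coordinates in `I \ {i}`. -/
def projRegionErase {n : ℕ} (p : Finset (Fin n) → ℝ) (I : Finset (Fin n)) (i : Fin n) :
    Set (↥(I.erase i) → ℝ) :=
  Finset.restrict₂ (π := fun _ => ℝ) (Finset.erase_subset i I) '' projRegion p I

/-- `δ_n(I)`: the `|I|`-dimensional volume of `π_I(D_I)` minus `1 / (n + 1)` times the sum over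
`i ∈ I` of the `(|I| - 1)`-dimensional volumes of its projections along the coordinate `i`. -/
noncomputable def deficiency {n : ℕ} (p : Finset (Fin n) → ℝ) (I : Finset (Fin n)) : ℝ :=
  volume.real (projRegion p I) -
    1 / ((n : ℝ) + 1) * ∑ i ∈ I, volume.real (projRegionErase p I i)

def Submodular {n : ℕ} (p : Finset (Fin n) → ℝ) : Prop :=
  ∀ I J : Finset (Fin n), p (I ∪ J) + p (I ∩ J) ≤ p I + p J

/-- A price schedule is normalized if every bundle (other than the full one) whose region has
volume zero is priced like its cheapest proper super-bundle. -/
def Normalized {n : ℕ} (p : Finset (Fin n) → ℝ) : Prop :=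
  ∀ I : Finset (Fin n), I ≠ univ → regionVol p I = 0 → IsLeast (p '' {J | I ⊂ J}) (p I)

/-- `K` is the union or the intersection of two bundles for which the submodularity inequality
is an equality. Only incomparable pairs count: for comparable ones equality is automatic. -/
def LeftTight {n : ℕ} (p : Finset (Fin n) → ℝ) (K : Finset (Fin n)) : Prop :=
  ∃ I J : Finset (Fin n), ¬ I ⊆ J ∧ ¬ J ⊆ I ∧
    p (I ∪ J) + p (I ∩ J) = p I + p J ∧ (K = I ∪ J ∨ K = I ∩ J)

/-- `K` is one of two incomparable bundles for which the submodularity inequality is an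
equality. -/
def RightTight {n : ℕ} (p : Finset (Fin n) → ℝ) (K : Finset (Fin n)) : Prop :=
  ∃ J : Finset (Fin n), ¬ K ⊆ J ∧ ¬ J ⊆ K ∧ p (K ∪ J) + p (K ∩ J) = p K + p J

def Tight {n : ℕ} (p : Finset (Fin n) → ℝ) (K : Finset (Fin n)) : Prop :=
  LeftTight p K ∨ RightTight p K

/-- The four necessary critical point conditions at the bundle `I`. -/
structure CriticalPointConditions {n : ℕ} (p : Finset (Fin n) → ℝ) (I : Finset (Fin n)) :
    Prop where
  not_tight_pos : ¬ Tight p I → 0 < regionVol p I → deficiency p I = 0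
  not_tight_zero : ¬ Tight p I → regionVol p I = 0 → 0 ≤ deficiency p I
  just_left_tight : LeftTight p I → ¬ RightTight p I → 0 ≤ deficiency p I
  just_right_tight : RightTight p I → ¬ LeftTight p I → 0 < regionVol p I → deficiency p I ≤ 0

/-- The selling candidate `𝓘_{k,n}`: all bundles with at most `k` items, and the full bundle. -/
def candidate (k n : ℕ) : Set (Finset (Fin n)) :=
  {I | #I ≤ k ∨ I = univ}

/-- The polytope of all `x ∈ [0,1]^I` with `∑ j ∈ J, x j ≤ q J` for all `J ⊆ I`; for the solution
procedure this is `π_I(D_∅)`, expressed through the prices of the sub-bundles of `I` alone. -/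
def emptyBody {n : ℕ} (q : Finset (Fin n) → ℝ) (I : Finset (Fin n)) : Set (I → ℝ) :=
  {x | (∀ i, x i ∈ Set.Icc (0 : ℝ) 1) ∧
    ∀ J : Finset I, ∑ j ∈ J, x j ≤ q (J.map (Function.Embedding.subtype _))}

/-- A selling candidate `𝓘` is solvable if prices `q I` can be chosen for `I ∈ 𝓘`, each in
the interval `[0, q̂ I]` and such that the volume of `emptyBody q I` is `1 - |I| / (n + 1)`. Here
`q̂ I` is the largest value of `q I` with `q I + q (J ∩ J') ≤ q J + q J'` whenever `J ∪ J' = I`.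
Bundles outside `𝓘` get the price `|J|`, which puts no constraint on valuations in the cube. -/
def Solvable {n : ℕ} (𝓘 : Set (Finset (Fin n))) : Prop :=
  ∃ q : Finset (Fin n) → ℝ, q ∅ = 0 ∧ (∀ J, J ∉ 𝓘 → q J = #J) ∧
    ∀ I ∈ 𝓘,
      0 ≤ q I ∧
      (∀ J J' : Finset (Fin n), J ∪ J' = I → q I + q (J ∩ J') ≤ q J + q J') ∧
      volume.real (emptyBody q I) = 1 - (#I : ℝ) / ((n : ℝ) + 1)

/-- The price schedule `p` is critical with respect to `𝓘`: the bundles whose region has positive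
volume are those in `𝓘`, and the nonempty ones among them have `δ_n(I) = 0`. -/
def Critical {n : ℕ} (p : Finset (Fin n) → ℝ) (𝓘 : Set (Finset (Fin n))) : Prop :=
  (∀ I, 0 < regionVol p I ↔ I ∈ 𝓘) ∧ ∀ I ∈ 𝓘, I ≠ ∅ → deficiency p I = 0

/-- `p` is a normalized, submodular price schedule that is critical with respect to `𝓘_{k,n}` and
symmetric, that is, on `𝓘_{k,n}` the price depends only on the cardinality. -/
structure IsSymmetricCritical {n : ℕ} (k : ℕ) (p : Finset (Fin n) → ℝ) : Prop where
  schedule : IsPriceSchedule p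
  normalized : Normalized p
  submodular : Submodular p
  symmetric : ∀ I ∈ candidate k n, ∀ J ∈ candidate k n, #I = #J → p I = p J
  critical : Critical p (candidate k n)

/-- `p` is the price schedule of the straight jacket auction: it is normalized, submodular,
symmetric and critical with respect to `𝓘_{k,n}`, where `k ∈ {1, …, n}` is the largest number for
which such prices exist. -/
def IsSJA {n : ℕ} (p : Finset (Fin n) → ℝ) : Prop :=
  ∃ k : ℕ, IsGreatest
      {m : ℕ | m ∈ Set.Icc 1 n ∧ ∃ p' : Finset (Fin n) → ℝ, IsSymmetricCritical m p'} k ∧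
    IsSymmetricCritical k p

end Auction

namespace Auction

open MeasureTheory Finset

/-! For prices that depend only on the size of the bundle through a concave function, each region is
a product of an upper body (coordinates inside the bundle) and a lower body (coordinates outside).
The regions tile the cube, so their volumes sum to 1. Combining this identity for `m` items with the
one for `m - 1` items and shifted prices gives `sum_symDeficiency`: the deficiencies of sizes `j ≤
m`, weighted by lower volumes, sum to `1 - m / (n + 1)`. When the intermediate terms vanish, only `j
= 0` and `j = m` survive (`lowerVol_add_symDeficiency`), so a zero deficiency at size `m` is the
same as the volume equation of the solution procedure.

Lower volumes are strictly monotone in the total price (`lowerVol_lt`). Hence a solution of the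
volume equations is automatically symmetric, given by a concave `g` (`exists_symmetricSolution`),
and truncating `g` at `g n` yields a critical schedule, so an SJA exists. Conversely, an SJA with
parameter `k` agrees with `g` up to size `k`, and its top price is at most `g n`. The conditions are
immediate on the candidate, where deficiencies vanish. Outside it regions are null: bundles of size
at least `k + 2` are right tight, and at size `k + 1` the comparison with `g` makes the deficiency
nonnegative (`IsSymmetricCritical.deficiency_nonneg`). -/

/-! ### Concave functions of the bundle size. -/

/-- `g` is concave on `{0, …, n}`. -/
def ConcaveUpTo (n : ℕ) (g : ℕ → ℝ) : Prop :=
  ∀ j, j + 2 ≤ n → g (j + 2) + g j ≤ 2 * g (j + 1)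

theorem ConcaveUpTo.mono {n m : ℕ} {g : ℕ → ℝ} (hg : ConcaveUpTo n g) (h : m ≤ n) :
    ConcaveUpTo m g := fun j hj => hg j (hj.trans h)

theorem ConcaveUpTo.shift {n : ℕ} {g : ℕ → ℝ} (hg : ConcaveUpTo (n + 1) g) (c : ℝ) :
    ConcaveUpTo n (fun k => g (k + 1) - c) := by
  intro j hj
  have := hg (j + 1) (by omega)
  have e : j + 1 + 2 = j + 2 + 1 := by ring
  rw [e] at this
  simp only
  linarith

theorem ConcaveUpTo.min_const {n : ℕ} {g : ℕ → ℝ} (hg : ConcaveUpTo n g) (c : ℝ) :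
    ConcaveUpTo n (fun k => min (g k) c) := by
  intro j hj
  have h := hg j hj
  simp only
  rcases min_cases (g (j + 1)) c with h1 | h1 <;>
    linarith [min_le_left (g j) c, min_le_right (g j) c, min_le_left (g (j + 2)) c,
      min_le_right (g (j + 2)) c]

theorem ConcaveUpTo.diff_le {n : ℕ} {g : ℕ → ℝ} (hg : ConcaveUpTo n g) {i j : ℕ} (hij : i ≤ j)
    (hj : j + 1 ≤ n) : g (j + 1) - g j ≤ g (i + 1) - g i := by
  induction j, hij using Nat.le_induction with
  | base => exact le_rfl
  | succ j hij ih =>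
    have := hg j (by omega)
    have := ih (by omega)
    have e : j + 1 + 1 = j + 2 := rfl
    rw [e]
    linarith

theorem ConcaveUpTo.add_le {n : ℕ} {g : ℕ → ℝ} (hg : ConcaveUpTo n g) (i s t : ℕ)
    (h : i + s + t ≤ n) : g (i + s + t) + g i ≤ g (i + s) + g (i + t) := by
  induction t with
  | zero => simp
  | succ t ih =>
    have h1 := ih (by omega)
    have h2 := hg.diff_le (i := i + t) (j := i + s + t) (by omega) (by omega)
    have e1 : i + s + (t + 1) = i + s + t + 1 := by ring
    have e2 : i + (t + 1) = i + t + 1 := by ring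
    rw [e1, e2]
    linarith

theorem ConcaveUpTo.submodular {n : ℕ} {g : ℕ → ℝ} (hg : ConcaveUpTo n g) :
    Submodular (fun I : Finset (Fin n) => g #I) := by
  intro I J
  have h1 : #(I ∪ J) + #(I ∩ J) = #I + #J := card_union_add_card_inter I J
  have h2 : #(I ∩ J) ≤ #I := card_le_card inter_subset_left
  have h3 : #(I ∩ J) ≤ #J := card_le_card inter_subset_right
  have h4 : #(I ∪ J) ≤ n := card_finset_fin_le _
  have := hg.add_le #(I ∩ J) (#I - #(I ∩ J)) (#J - #(I ∩ J)) (by omega)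
  have e1 : #(I ∩ J) + (#I - #(I ∩ J)) = #I := by omega
  have e2 : #(I ∩ J) + (#J - #(I ∩ J)) = #J := by omega
  have e3 : #I + (#J - #(I ∩ J)) = #(I ∪ J) := by omega
  rwa [e1, e2, e3] at this

/-- Each increment beyond `j` is at most each of the first `j` increments, hence at most their
average `g j / j`. -/
theorem ConcaveUpTo.mul_le {n : ℕ} {g : ℕ → ℝ} (hg : ConcaveUpTo n g) (h0 : g 0 = 0) {j m : ℕ}
    (hjm : j ≤ m) (hm : m ≤ n) : (j : ℝ) * g m ≤ m * g j := by
  induction m, hjm using Nat.le_induction with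
  | base => exact le_rfl
  | succ m hjm ih =>
    have h1 := ih (by omega)
    have h2 : (j : ℝ) * (g (m + 1) - g m) ≤ g j := by
      clear ih h1
      induction j with
      | zero => simp [h0]
      | succ j ih =>
        have h3 := ih (by omega)
        have h4 := hg.diff_le (i := j) (j := m) (by omega) hm
        push_cast
        linarith
    push_cast
    linarith

theorem ConcaveUpTo.sub_le {n : ℕ} {g : ℕ → ℝ} (hg : ConcaveUpTo n g) (h0 : g 0 = 0) (j k : ℕ)
    (h : j + k ≤ n) : g (j + k) - g j ≤ k * g 1 := by
  induction k with
  | zero => simp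
  | succ k ih =>
    have h1 := ih (by omega)
    have h2 := hg.diff_le (i := 0) (j := j + k) (by omega) (by omega)
    rw [h0, zero_add] at h2
    rw [← add_assoc]
    push_cast
    linarith

/-! ### Lower and upper bodies in the cube. -/

/-- The points of the unit cube whose partial sums over `K` are at most `c #K`. -/
def lowerBody (ι : Type*) (c : ℕ → ℝ) : Set (ι → ℝ) :=
  {x | (∀ i, x i ∈ Set.Icc (0 : ℝ) 1) ∧ ∀ K : Finset ι, ∑ i ∈ K, x i ≤ c #K}

/-- The points of the unit cube whose partial sums over `K` are at least `c #K`. -/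
def upperBody (ι : Type*) (c : ℕ → ℝ) : Set (ι → ℝ) :=
  {x | (∀ i, x i ∈ Set.Icc (0 : ℝ) 1) ∧ ∀ K : Finset ι, c #K ≤ ∑ i ∈ K, x i}

noncomputable def lowerVol (m : ℕ) (c : ℕ → ℝ) : ℝ := volume.real (lowerBody (Fin m) c)

noncomputable def upperVol (m : ℕ) (c : ℕ → ℝ) : ℝ := volume.real (upperBody (Fin m) c)

theorem isClosed_cube (ι : Type*) : IsClosed {x : ι → ℝ | ∀ i, x i ∈ Set.Icc (0 : ℝ) 1} := by
  simp only [Set.ofPred_forall]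
  exact isClosed_iInter fun i => isClosed_Icc.preimage (continuous_apply i)

theorem cube_eq_pi (ι : Type*) :
    {x : ι → ℝ | ∀ i, x i ∈ Set.Icc (0 : ℝ) 1} = Set.univ.pi fun _ => Set.Icc 0 1 := by
  ext x; simp only [Set.mem_ofPred_eq, Set.mem_pi, Set.mem_univ, true_imp_iff]

theorem volume_cube (ι : Type*) [Fintype ι] :
    volume {x : ι → ℝ | ∀ i, x i ∈ Set.Icc (0 : ℝ) 1} = 1 := by
  rw [cube_eq_pi, volume_pi_pi]
  simp

theorem volume_ne_top_of_subset_cube {ι : Type*} [Fintype ι] {s : Set (ι → ℝ)}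
    (h : ∀ x ∈ s, ∀ i, x i ∈ Set.Icc (0 : ℝ) 1) : volume s ≠ ⊤ :=
  ((measure_mono h).trans_lt ((volume_cube ι).trans_lt ENNReal.one_lt_top)).ne

theorem piCongrLeft_const {ι κ : Type*} (e : ι ≃ κ) (x : ι → ℝ) (k : κ) :
    MeasurableEquiv.piCongrLeft (fun _ => ℝ) e x k = x (e.symm k) := by
  obtain ⟨i, rfl⟩ := e.surjective k
  rw [MeasurableEquiv.coe_piCongrLeft, Equiv.piCongrLeft_apply_apply, e.symm_apply_apply]

/-- Relabelling coordinates preserves volume, and the constraints see `K` only through its size. The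
relation `F` covers lower and upper bodies at once. -/
theorem volume_body_eq {ι κ : Type*} [Fintype ι] [Fintype κ] (e : ι ≃ κ)
    (F : ℕ → ℝ → Prop) :
    volume {x : ι → ℝ | (∀ i, x i ∈ Set.Icc (0 : ℝ) 1) ∧ ∀ K : Finset ι, F #K (∑ i ∈ K, x i)} =
      volume
        {x : κ → ℝ | (∀ i, x i ∈ Set.Icc (0 : ℝ) 1) ∧ ∀ K : Finset κ, F #K (∑ i ∈ K, x i)} := by
  rw [← (volume_measurePreserving_piCongrLeft (fun _ => ℝ) e).measure_preimage_equiv]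
  congr 1
  ext x
  simp only [Set.mem_preimage, Set.mem_ofPred_eq, piCongrLeft_const]
  refine and_congr (e.symm.forall_congr_left.trans (by simp)).symm ?_
  constructor
  · intro h K
    have := h (K.map e.symm.toEmbedding)
    simpa using this
  · intro h K
    have := h (K.map e.toEmbedding)
    simpa using this

theorem volume_lowerBody (ι : Type*) [Fintype ι] (c : ℕ → ℝ) :
    volume.real (lowerBody ι c) = lowerVol (Fintype.card ι) c :=
  congrArg ENNReal.toReal (volume_body_eq (Fintype.equivFin ι) fun k s => s ≤ c k)

theorem volume_upperBody (ι : Type*) [Fintype ι] (c : ℕ → ℝ) :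
    volume.real (upperBody ι c) = upperVol (Fintype.card ι) c :=
  congrArg ENNReal.toReal (volume_body_eq (Fintype.equivFin ι) fun k s => c k ≤ s)

theorem lowerVol_congr {m : ℕ} {c d : ℕ → ℝ} (h : ∀ j ≤ m, c j = d j) :
    lowerVol m c = lowerVol m d := by
  unfold lowerVol lowerBody
  congr 1
  ext x
  simp only [Set.mem_ofPred_eq, h _ (card_finset_fin_le _)]

theorem upperVol_congr {m : ℕ} {c d : ℕ → ℝ} (h : ∀ j ≤ m, c j = d j) :
    upperVol m c = upperVol m d := by
  unfold upperVol upperBody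
  congr 1
  ext x
  simp only [Set.mem_ofPred_eq, h _ (card_finset_fin_le _)]

theorem lowerVol_mono {m : ℕ} {c d : ℕ → ℝ} (h : ∀ j ≤ m, c j ≤ d j) :
    lowerVol m c ≤ lowerVol m d :=
  measureReal_mono (fun _ hx => ⟨hx.1, fun K => (hx.2 K).trans (h _ (card_finset_fin_le _))⟩)
    (volume_ne_top_of_subset_cube fun _ hx => hx.1)

/-! ### Product structure of the regions and the volume identities. -/

theorem forall_finset_subtype {ι : Type*} {P : ι → Prop} [DecidablePred P] (x : ι → ℝ)
    (F : ℕ → ℝ → Prop) :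
    (∀ K : Finset {i // P i}, F #K (∑ i ∈ K, x i)) ↔
      ∀ K : Finset ι, (∀ i ∈ K, P i) → F #K (∑ i ∈ K, x i) := by
  constructor
  · intro h K hK
    have := h (K.subtype P)
    rwa [card_subtype, sum_subtype_eq_sum_filter, filter_true_of_mem hK] at this
  · intro h K
    have := h (K.map (Function.Embedding.subtype P)) (by
      intro i hi
      obtain ⟨j, -, rfl⟩ := mem_map.1 hi
      exact j.2)
    rwa [card_map, sum_map] at this

/-- The region of `J` splits along the coordinates inside and outside of `J`. -/
theorem region_eq_preimage {m : ℕ} {g : ℕ → ℝ} (hg : ConcaveUpTo m g) (J : Finset (Fin m)) :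
    region (fun I : Finset (Fin m) => g #I) J =
      MeasurableEquiv.piEquivPiSubtypeProd (fun _ => ℝ) (· ∈ J) ⁻¹'
        (upperBody {i // i ∈ J} (fun k => g #J - g (#J - k)) ×ˢ
          lowerBody {i // i ∉ J} (fun k => g (#J + k) - g #J)) := by
  ext x
  have hup := forall_finset_subtype (P := (· ∈ J)) x (fun k s => g #J - g (#J - k) ≤ s)
  have hlo := forall_finset_subtype (P := (· ∉ J)) x (fun k s => s ≤ g (#J + k) - g #J)
  simp only [region, Set.mem_ofPred_eq, Set.mem_preimage, Set.mem_prod, upperBody, lowerBody,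
    MeasurableEquiv.piEquivPiSubtypeProd, MeasurableEquiv.coe_mk,
    Equiv.piEquivPiSubtypeProd_apply, Subtype.forall]
  rw [hup, hlo]
  constructor
  · rintro ⟨hc, h⟩
    refine ⟨⟨fun i _ => hc i, fun K hK => ?_⟩, fun i _ => hc i, fun K hK => ?_⟩
    · have h1 := h (J \ K)
      have h2 := sum_sdiff (f := x) (s₁ := K) (s₂ := J) hK
      rw [card_sdiff_of_subset hK] at h1
      linarith
    · have hd : Disjoint J K := disjoint_right.2 hK
      have h1 := h (J ∪ K)
      rw [card_union_of_disjoint hd, sum_union hd] at h1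
      linarith
  · rintro ⟨⟨hc1, h1⟩, hc2, h2⟩
    refine ⟨fun i => ?_, fun L => ?_⟩
    · by_cases hi : i ∈ J
      · exact hc1 i hi
      · exact hc2 i hi
    -- Moving from `J` to `L` drops `J \ L` and adds `L \ J`; concavity makes the two separate
    -- constraints strong enough for the combined move.
    · have a1 := h1 (J \ L) (fun i hi => (mem_sdiff.1 hi).1)
      have a2 := h2 (L \ J) (fun i hi => (mem_sdiff.1 hi).2)
      have s1 := sum_inter_add_sum_sdiff J L x
      have s2 := sum_inter_add_sum_sdiff L J x
      rw [inter_comm] at s2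
      have c1 := card_inter_add_card_sdiff J L
      have c2 := card_inter_add_card_sdiff L J
      rw [inter_comm] at c2
      have c3 : #J + #(L \ J) ≤ m := by
        rw [← card_union_of_disjoint disjoint_sdiff]
        exact card_finset_fin_le _
      have := hg.add_le #(J ∩ L) #(J \ L) #(L \ J) (by omega)
      rw [c1, c2] at this
      have e : #J - #(J \ L) = #(J ∩ L) := by omega
      rw [e] at a1
      linarith

theorem regionVol_eq {m : ℕ} {g : ℕ → ℝ} (hg : ConcaveUpTo m g) (J : Finset (Fin m)) :
    regionVol (fun I : Finset (Fin m) => g #I) J =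
      upperVol #J (fun k => g #J - g (#J - k)) *
        lowerVol (m - #J) (fun k => g (#J + k) - g #J) := by
  have hp := volume_preserving_piEquivPiSubtypeProd (fun _ : Fin m => ℝ) (· ∈ J)
  rw [regionVol, region_eq_preimage hg, measureReal_def, hp.measure_preimage_equiv,
    ← measureReal_def]
  refine (measureReal_prod_prod _ _).trans ?_
  rw [volume_upperBody, volume_lowerBody]
  congr 2
  · simp
  · rw [Fintype.card_subtype_compl]; simp

theorem isClosed_region {m : ℕ} (p : Finset (Fin m) → ℝ) (J : Finset (Fin m)) :
    IsClosed (region p J) := by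
  refine (isClosed_cube _).inter (s₂ := {x | ∀ K : Finset (Fin m), _}) ?_
  simp only [Set.ofPred_forall]
  exact isClosed_iInter fun K => isClosed_le (by fun_prop) (by fun_prop)

theorem volume_hyperplane {m : ℕ} {J K : Finset (Fin m)} (h : J ≠ K) (c : ℝ) :
    volume {x : Fin m → ℝ | ∑ i ∈ J, x i - ∑ i ∈ K, x i = c} = 0 := by
  let f : (Fin m → ℝ) →ₗ[ℝ] ℝ :=
    ∑ i ∈ J, LinearMap.proj i - ∑ i ∈ K, LinearMap.proj i
  have hf : ∀ x, f x = ∑ i ∈ J, x i - ∑ i ∈ K, x i := fun x => by simp [f]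
  have hs : {x : Fin m → ℝ | ∑ i ∈ J, x i - ∑ i ∈ K, x i = c} =
      ((AffineSubspace.mk' c (⊥ : Submodule ℝ ℝ)).comap f.toAffineMap : AffineSubspace ℝ _) := by
    ext x
    simp [← hf, sub_eq_zero]
  rw [hs]
  refine Measure.addHaar_affineSubspace _ _ fun htop => h ?_
  have hx : ∀ x, f x = c := fun x => by
    have : x ∈ (AffineSubspace.mk' c (⊥ : Submodule ℝ ℝ)).comap f.toAffineMap := by
      rw [htop]; trivial
    simpa [sub_eq_zero] using this
  -- If the hyperplane were everything, the functional would vanish, and its values at the unit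
  -- vectors would give `J = K`.
  have hc : c = 0 := by rw [← hx 0, map_zero]
  ext i
  have := hx (Pi.single i 1)
  rw [hc, hf] at this
  simp only [Pi.single_apply, sum_ite_eq'] at this
  by_cases h1 : i ∈ J <;> by_cases h2 : i ∈ K <;> simp_all

/-- Every valuation has a utility-maximizing bundle, so the regions cover the cube; two of them meet
only where two utilities tie, inside a hyperplane. -/
theorem sum_regionVol {m : ℕ} (p : Finset (Fin m) → ℝ) : ∑ J, regionVol p J = 1 := by
  have hfin : ∀ J ∈ (univ : Finset (Finset (Fin m))), volume (region p J) ≠ ⊤ :=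
    fun J _ => volume_ne_top_of_subset_cube fun x hx => hx.1
  simp only [regionVol]
  rw [← measureReal_biUnion_finset₀ _ _ hfin]
  · have : (⋃ J ∈ (univ : Finset (Finset (Fin m))), region p J) =
        {x | ∀ i, x i ∈ Set.Icc (0 : ℝ) 1} := by
      ext x
      simp only [mem_univ, Set.iUnion_true, Set.mem_iUnion]
      constructor
      · rintro ⟨J, hJ⟩
        exact hJ.1
      · intro hx
        obtain ⟨J, -, hJ⟩ := exists_max_image univ
          (fun J : Finset (Fin m) => ∑ j ∈ J, x j - p J) univ_nonempty
        exact ⟨J, hx, fun K => hJ K (mem_univ _)⟩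
    rw [this, measureReal_def, volume_cube]
    simp
  · intro J _ K _ hJK
    refine measure_mono_null ?_ (volume_hyperplane hJK (p J - p K))
    rintro x ⟨h1, h2⟩
    have := h1.2 K
    have := h2.2 J
    simp only [Set.mem_ofPred_eq]
    linarith
  · exact fun J _ => (isClosed_region p J).measurableSet.nullMeasurableSet

theorem sum_choose_mul_vol {m : ℕ} {g : ℕ → ℝ} (hg : ConcaveUpTo m g) :
    ∑ j ∈ range (m + 1), (m.choose j : ℝ) * (upperVol j (fun k => g j - g (j - k)) *
      lowerVol (m - j) (fun k => g (j + k) - g j)) = 1 := by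
  rw [← sum_regionVol (fun I : Finset (Fin m) => g #I)]
  simp only [regionVol_eq hg]
  rw [← powerset_univ, sum_powerset_apply_card (fun j => upperVol j (fun k => g j - g (j - k)) *
      lowerVol (m - j) (fun k => g (j + k) - g j))]
  simp

/-- The deficiency of a bundle of size `j` under symmetric prices `g`. -/
noncomputable def symDeficiency (n : ℕ) (g : ℕ → ℝ) (j : ℕ) : ℝ :=
  upperVol j (fun k => g j - g (j - k)) -
    1 / ((n : ℝ) + 1) * (j * upperVol (j - 1) (fun k => g j - g (j - k)))

/-- The first halves of the deficiencies give the tiling identity for `m` items. By `j * C(m, j) = m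
* C(m - 1, j - 1)`, the second halves give `m` times the tiling identity for `m - 1` items with
prices `g (k + 1) - g 1`. -/
theorem sum_symDeficiency (n : ℕ) {m : ℕ} {g : ℕ → ℝ} (hg : ConcaveUpTo m g) :
    ∑ j ∈ range (m + 1), (m.choose j : ℝ) * (symDeficiency n g j *
      lowerVol (m - j) (fun k => g (j + k) - g j)) = 1 - (m : ℝ) / ((n : ℝ) + 1) := by
  have h1 := sum_choose_mul_vol hg
  have h2 : ∑ j ∈ range (m + 1), (m.choose j : ℝ) *
      (j * upperVol (j - 1) (fun k => g j - g (j - k)) *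
        lowerVol (m - j) (fun k => g (j + k) - g j)) = m := by
    cases m with
    | zero => simp
    | succ m =>
      have h3 := sum_choose_mul_vol (hg.shift (g 1))
      rw [sum_range_succ']
      simp only [Nat.cast_zero, zero_mul, mul_zero, add_zero]
      rw [← mul_one ((m + 1 : ℕ) : ℝ), ← h3, mul_sum]
      refine sum_congr rfl fun j hj => ?_
      have hjm : j ≤ m := by simpa [Nat.lt_succ_iff] using hj
      have e1 : upperVol j (fun k => g (j + 1) - g 1 - (g (j - k + 1) - g 1)) =
          upperVol (j + 1 - 1) (fun k => g (j + 1) - g (j + 1 - k)) := by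
        refine upperVol_congr fun k hk => ?_
        rw [Nat.sub_add_comm hk]
        ring
      have e2 : lowerVol (m - j) (fun k => g (j + k + 1) - g 1 - (g (j + 1) - g 1)) =
          lowerVol (m + 1 - (j + 1)) (fun k => g (j + 1 + k) - g (j + 1)) := by
        rw [Nat.add_sub_add_right]
        refine lowerVol_congr fun k _ => ?_
        rw [add_right_comm]
        ring
      have e3 : ((m + 1).choose (j + 1) : ℝ) * ((j + 1 : ℕ) : ℝ) =
          ((m + 1 : ℕ) : ℝ) * (m.choose j : ℝ) := by
        exact_mod_cast (Nat.add_one_mul_choose_eq m j).symm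
      rw [e1, e2, ← mul_assoc, ← mul_assoc, e3]
      ring
  have h3 : (1 : ℝ) - (m : ℝ) / ((n : ℝ) + 1) = 1 - 1 / ((n : ℝ) + 1) * m := by ring
  rw [h3]
  calc _ = _ := ?_
    _ = _ := congrArg₂ (fun a b => a - 1 / ((n : ℝ) + 1) * b) h1 h2
  rw [mul_sum, ← sum_sub_distrib]
  refine sum_congr rfl fun j _ => ?_
  rw [symDeficiency]
  ring

/-! ### Projections of regions as upper bodies. -/

theorem mem_upperBody_of_extend {n : ℕ} {I : Finset (Fin n)} {c : ℕ → ℝ} {x : Fin n → ℝ} :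
    I.restrict x ∈ upperBody I c ↔
      (∀ i ∈ I, x i ∈ Set.Icc (0 : ℝ) 1) ∧ ∀ K ⊆ I, c #K ≤ ∑ i ∈ K, x i := by
  have h := forall_finset_subtype (P := (· ∈ I)) x (fun k s => c k ≤ s)
  simp only [upperBody, Set.mem_ofPred_eq, Finset.restrict, Subtype.forall]
  exact and_congr Iff.rfl h

theorem projRegion_eq {n : ℕ} {g : ℕ → ℝ} (hmono : ∀ i j, i ≤ j → j ≤ n → g i ≤ g j)
    (I : Finset (Fin n)) :
    projRegion (fun J : Finset (Fin n) => g #J) I =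
      upperBody I (fun k => g #I - g (#I - k)) := by
  ext y
  constructor
  · rintro ⟨x, ⟨hc, h⟩, rfl⟩
    refine mem_upperBody_of_extend.2 ⟨fun i _ => hc i, fun K hK => ?_⟩
    have h1 := h (I \ K)
    have h2 := sum_sdiff (f := x) hK
    simp only [card_sdiff_of_subset hK] at h1
    linarith
  · intro hy
    -- With value 0 outside `I`, a bundle `L` is worth no more than `I ∩ L`, which monotonicity
    -- makes no dearer.
    let x : Fin n → ℝ := fun i => if h : i ∈ I then y ⟨i, h⟩ else 0
    have hx : I.restrict x = y := by
      ext i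
      simp [x]
    refine ⟨x, ⟨?_, ?_⟩, hx⟩
    · intro i
      by_cases h : i ∈ I
      · simpa [x, h] using hy.1 ⟨i, h⟩
      · simp [x, h]
    · rw [← hx, mem_upperBody_of_extend] at hy
      intro L
      have h1 := hy.2 (I \ L) sdiff_subset
      have h2 := sum_inter_add_sum_sdiff I L x
      have h3 : ∑ i ∈ I ∩ L, x i = ∑ i ∈ L, x i := by
        refine sum_subset inter_subset_right fun i hi hi' => ?_
        have : i ∉ I := fun h => hi' (mem_inter.2 ⟨h, hi⟩)
        simp [x, this]
      have h4 := card_inter_add_card_sdiff I L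
      have h5 : g #(I ∩ L) ≤ g #L :=
        hmono _ _ (card_le_card inter_subset_right) (card_finset_fin_le _)
      have e : #I - #(I \ L) = #(I ∩ L) := by omega
      simp only [e] at h1
      linarith

theorem projRegionErase_eq {n : ℕ} {g : ℕ → ℝ} (hg : ConcaveUpTo n g) (h0 : g 0 = 0)
    (h1 : g 1 ≤ 1) (hmono : ∀ i j, i ≤ j → j ≤ n → g i ≤ g j) {I : Finset (Fin n)} {i : Fin n}
    (hi : i ∈ I) :
    projRegionErase (fun J : Finset (Fin n) => g #J) I i =
      upperBody ↥(I.erase i) (fun k => g #I - g (#I - k)) := by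
  rw [projRegionErase, projRegion_eq hmono]
  ext y
  constructor
  · rintro ⟨z, hz, rfl⟩
    let x : Fin n → ℝ := fun i => if h : i ∈ I then z ⟨i, h⟩ else 0
    have hx : I.restrict x = z := by
      ext i
      simp [x]
    have hx' : (I.erase i).restrict x =
        Finset.restrict₂ (π := fun _ => ℝ) (Finset.erase_subset i I) z := by
      rw [← hx]
      rfl
    rw [← hx, mem_upperBody_of_extend] at hz
    rw [← hx', mem_upperBody_of_extend]
    exact ⟨fun j hj => hz.1 j (erase_subset _ _ hj),
      fun K hK => hz.2 K (hK.trans (erase_subset _ _))⟩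
  · intro hy
    -- Setting `x i = 1` meets every constraint containing `i`: including `i` raises the required
    -- sum by one increment of `g`, at most `g 1 ≤ 1`.
    let x : Fin n → ℝ := fun j => if h : j ∈ I.erase i then y ⟨j, h⟩ else 1
    have hx : (I.erase i).restrict x = y := by
      ext j
      simp only [Finset.restrict, x, j.2, dif_pos]
    have hxi : x i = 1 := by simp [x]
    refine ⟨I.restrict x, ?_, hx⟩
    rw [← hx, mem_upperBody_of_extend] at hy
    rw [mem_upperBody_of_extend]
    refine ⟨fun j hj => ?_, fun K hK => ?_⟩
    · by_cases hji : j = i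
      · subst hji
        simp [hxi]
      · exact hy.1 j (mem_erase.2 ⟨hji, hj⟩)
    · by_cases hiK : i ∈ K
      · have a1 := hy.2 (K.erase i) (erase_subset_erase _ hK)
        have a2 := add_sum_erase K x hiK
        have a3 := card_erase_add_one hiK
        have a4 := card_le_card hK
        have a5 : #I ≤ n := card_finset_fin_le _
        have a6 := hg.diff_le (i := 0) (j := #I - #K) (by omega) (by omega)
        have e : #I - #(K.erase i) = #I - #K + 1 := by omega
        simp only [e] at a1
        simp only [zero_add, h0] at a6
        linarith
      · exact hy.2 K (subset_erase.2 ⟨hK, hiK⟩)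

theorem deficiency_eq {n : ℕ} {g : ℕ → ℝ} (hg : ConcaveUpTo n g) (h0 : g 0 = 0)
    (h1 : g 1 ≤ 1) (hmono : ∀ i j, i ≤ j → j ≤ n → g i ≤ g j) (I : Finset (Fin n)) :
    deficiency (fun J : Finset (Fin n) => g #J) I = symDeficiency n g #I := by
  rw [deficiency, symDeficiency, projRegion_eq hmono, volume_upperBody, Fintype.card_coe]
  congr 2
  rw [← nsmul_eq_mul, ← sum_const]
  refine sum_congr rfl fun i hi => ?_
  rw [projRegionErase_eq hg h0 h1 hmono hi, volume_upperBody, Fintype.card_coe,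
    card_erase_of_mem hi]

/-! ### Strict monotonicity, positivity and vanishing of volumes. -/

theorem volume_lt_of_isOpen_subset {m : ℕ} {S T U : Set (Fin m → ℝ)} (hST : S ⊆ T)
    (hT : volume T ≠ ⊤) (hU : IsOpen U) (hne : U.Nonempty) (hUT : U ⊆ T) (hd : Disjoint S U) :
    volume.real S < volume.real T := by
  have h1 : volume.real (S ∪ U) ≤ volume.real T := measureReal_mono (Set.union_subset hST hUT) hT
  rw [measureReal_union hd hU.measurableSet (measure_ne_top_of_subset hST hT)
    (measure_ne_top_of_subset hUT hT)] at h1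
  have h2 : 0 < volume.real U :=
    ENNReal.toReal_pos (hU.measure_pos volume hne).ne' (measure_ne_top_of_subset hUT hT)
  linarith

/-- For `t` between `max (h m) 0` and `f m`, the constant point `t / m` violates the total bound of
`h` but, by concavity, satisfies all nonempty bounds of `f` strictly. An open neighbourhood is
therefore gained. -/
theorem lowerVol_lt {m : ℕ} {f h : ℕ → ℝ} (hf : ConcaveUpTo m f) (f0 : f 0 = 0) (f1 : f 1 ≤ 1)
    (hm : 1 ≤ m) (hle : ∀ j ≤ m, h j ≤ f j) (hlt : h m < f m) (hpos : 0 < f m) :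
    lowerVol m h < lowerVol m f := by
  obtain ⟨t, ht1, ht2⟩ := exists_between (max_lt hlt hpos)
  have ht0 : 0 < t := (le_max_right _ _).trans_lt ht1
  replace ht1 : h m < t := (le_max_left _ _).trans_lt ht1
  have hm' : (0 : ℝ) < m := by exact_mod_cast hm
  have key : ∀ k, 1 ≤ k → k ≤ m → (k : ℝ) * (t / m) < f k := by
    intro k hk hkm
    have hk' : (0 : ℝ) < k := by exact_mod_cast hk
    have := hf.mul_le f0 hkm le_rfl
    rw [← mul_div_assoc, div_lt_iff₀ hm']
    nlinarith
  refine volume_lt_of_isOpen_subset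
    (U := {x | (∀ i, 0 < x i) ∧ (∀ i, x i < 1) ∧ h m < ∑ i, x i ∧
      ∀ K : Finset (Fin m), K.Nonempty → ∑ i ∈ K, x i < f #K})
    (fun x hx => ⟨hx.1, fun K => (hx.2 K).trans (hle _ (card_finset_fin_le _))⟩)
    (volume_ne_top_of_subset_cube fun _ hx => hx.1) ?_ ⟨fun _ => t / m, ?_⟩ ?_ ?_
  · simp only [Set.ofPred_and, Set.ofPred_forall]
    refine IsOpen.inter ?_ (IsOpen.inter ?_ (IsOpen.inter ?_ ?_))
    · exact isOpen_iInter_of_finite fun i => isOpen_lt continuous_const (continuous_apply i)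
    · exact isOpen_iInter_of_finite fun i => isOpen_lt (continuous_apply i) continuous_const
    · exact isOpen_lt continuous_const (by fun_prop)
    · exact isOpen_iInter_of_finite fun K => isOpen_iInter_of_finite fun _ =>
        isOpen_lt (by fun_prop) continuous_const
  · have h1 := key 1 le_rfl hm
    rw [Nat.cast_one, one_mul] at h1
    refine ⟨fun _ => by positivity, fun _ => h1.trans_le f1, ?_, fun K hK => ?_⟩
    · simpa [mul_div_cancel₀ t hm'.ne'] using ht1
    · simpa using key #K hK.card_pos (card_finset_fin_le _)
  · rintro x ⟨h1, h2, -, h4⟩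
    refine ⟨fun i => ⟨(h1 i).le, (h2 i).le⟩, fun K => ?_⟩
    rcases K.eq_empty_or_nonempty with rfl | hK
    · simp [f0]
    · exact (h4 K hK).le
  · rw [Set.disjoint_left]
    rintro x hx ⟨-, -, h3, -⟩
    have := hx.2 univ
    rw [card_univ, Fintype.card_fin] at this
    linarith

/-- The body contains an open box at the all-ones corner. -/
theorem upperVol_pos {m : ℕ} {c : ℕ → ℝ} {r : ℝ} (hr : r < 1) (hc : ∀ k ≤ m, c k ≤ k * r) :
    0 < upperVol m c := by
  obtain ⟨s, hs1, hs2⟩ := exists_between (max_lt hr zero_lt_one)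
  have hs0 : 0 < s := (le_max_right _ _).trans_lt hs1
  replace hs1 : r < s := (le_max_left _ _).trans_lt hs1
  rw [← measureReal_empty (μ := (volume : Measure (Fin m → ℝ)))]
  refine volume_lt_of_isOpen_subset (U := Set.univ.pi fun _ => Set.Ioo (max r 0) 1)
    (Set.empty_subset _) (volume_ne_top_of_subset_cube fun _ hx => hx.1)
    (isOpen_set_pi Set.finite_univ fun _ _ => isOpen_Ioo)
    ⟨fun _ => s, fun _ _ => ⟨max_lt hs1 hs0, hs2⟩⟩ ?_ (Set.empty_disjoint _)
  intro x hx
  have hx' : ∀ i, max r 0 < x i ∧ x i < 1 := fun i => hx i trivial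
  refine ⟨fun i => ⟨(le_max_right _ _).trans (hx' i).1.le, (hx' i).2.le⟩, fun K => ?_⟩
  refine (hc _ (card_finset_fin_le _)).trans ?_
  rw [← nsmul_eq_mul]
  exact card_nsmul_le_sum _ _ _ fun i _ => (le_max_left _ _).trans (hx' i).1.le

theorem lowerVol_pos {m : ℕ} {c : ℕ → ℝ} {d : ℝ} (hd : 0 < d) (c0 : c 0 = 0)
    (hc : ∀ k, 1 ≤ k → k ≤ m → d ≤ c k) : 0 < lowerVol m c := by
  have hs : 0 < min (d / (m + 1)) 1 := lt_min (by positivity) one_pos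
  rw [← measureReal_empty (μ := (volume : Measure (Fin m → ℝ)))]
  refine volume_lt_of_isOpen_subset (U := Set.univ.pi fun _ => Set.Ioo 0 (min (d / (m + 1)) 1))
    (Set.empty_subset _) (volume_ne_top_of_subset_cube fun _ hx => hx.1)
    (isOpen_set_pi Set.finite_univ fun _ _ => isOpen_Ioo)
    ⟨fun _ => min (d / (m + 1)) 1 / 2, fun _ _ => ⟨half_pos hs, half_lt_self hs⟩⟩ ?_
    (Set.empty_disjoint _)
  intro x hx
  have hx' : ∀ i, 0 < x i ∧ x i < min (d / (m + 1)) 1 := fun i => hx i trivial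
  refine ⟨fun i => ⟨(hx' i).1.le, (hx' i).2.le.trans (min_le_right _ _)⟩, fun K => ?_⟩
  rcases K.eq_empty_or_nonempty with rfl | hK
  · simp [c0]
  · refine le_trans ?_ (hc _ hK.card_pos (card_finset_fin_le _))
    have h1 : ∑ i ∈ K, x i ≤ #K • (d / (m + 1)) :=
      sum_le_card_nsmul _ _ _ fun i _ => (hx' i).2.le.trans (min_le_left _ _)
    have h2 : (#K : ℝ) ≤ m := by exact_mod_cast card_finset_fin_le K
    rw [nsmul_eq_mul, mul_div_assoc'] at h1
    refine h1.trans ?_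
    rw [div_le_iff₀ (by positivity)]
    nlinarith

theorem volume_coord_eq {m : ℕ} (i : Fin m) (c : ℝ) :
    volume {x : Fin m → ℝ | x i = c} = 0 := by
  simpa using volume_hyperplane (J := {i}) (K := ∅) (by simp) c

theorem lowerVol_eq_zero {m k : ℕ} {c : ℕ → ℝ} (hk : 1 ≤ k) (hkm : k ≤ m) (hc : c k ≤ 0) :
    lowerVol m c = 0 := by
  obtain ⟨K, hK, rfl⟩ := exists_subset_card_eq
    (show k ≤ #(univ : Finset (Fin m)) by simpa using hkm)
  obtain ⟨i, hi⟩ := card_pos.1 hk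
  rw [lowerVol, measureReal_def, measure_mono_null _ (volume_coord_eq i 0), ENNReal.toReal_zero]
  intro x hx
  have h1 := single_le_sum (f := x) (fun j _ => (hx.1 j).1) hi
  exact le_antisymm (h1.trans ((hx.2 K).trans hc)) (hx.1 i).1

theorem upperVol_one_eq_zero {c : ℕ → ℝ} (hc : 1 ≤ c 1) : upperVol 1 c = 0 := by
  rw [upperVol, measureReal_def, measure_mono_null _ (volume_coord_eq 0 1), ENNReal.toReal_zero]
  intro x hx
  have := hx.2 {0}
  simp only [card_singleton, sum_singleton] at this
  exact le_antisymm (hx.1 0).2 (hc.trans this)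

theorem lowerVol_eq_one {m : ℕ} {c : ℕ → ℝ} (hc : ∀ k ≤ m, (k : ℝ) ≤ c k) :
    lowerVol m c = 1 := by
  have : lowerBody (Fin m) c = {x | ∀ i, x i ∈ Set.Icc (0 : ℝ) 1} := by
    refine Set.Subset.antisymm (fun x hx => hx.1) fun x hx => ⟨hx, fun K => ?_⟩
    refine le_trans ?_ (hc _ (card_finset_fin_le _))
    simpa using sum_le_card_nsmul K x 1 fun i _ => (hx i).2
  rw [lowerVol, this, measureReal_def, volume_cube, ENNReal.toReal_one]

theorem upperVol_zero {c : ℕ → ℝ} (hc : c 0 = 0) : upperVol 0 c = 1 := by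
  have : upperBody (Fin 0) c = {x | ∀ i, x i ∈ Set.Icc (0 : ℝ) 1} := by
    refine Set.Subset.antisymm (fun x hx => hx.1) fun x hx => ⟨hx, fun K => ?_⟩
    simp [Finset.eq_empty_of_isEmpty K, hc]
  rw [upperVol, this, measureReal_def, volume_cube, ENNReal.toReal_one]

/-! ### A simplex bound for the top price. -/

theorem volume_simplex_le (n : ℕ) {c : ℝ} (hc : 0 ≤ c) :
    volume {x : Fin n → ℝ | (∀ i, 0 ≤ x i) ∧ ∑ i, x i ≤ c} ≤
      ENNReal.ofReal (c ^ n / n.factorial) := by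
  induction n generalizing c with
  | zero =>
    refine (measure_mono (Set.subset_univ _)).trans ?_
    simp [volume_pi]
  | succ n ih =>
    have hp := volume_preserving_piFinSuccAbove (fun _ : Fin (n + 1) => ℝ) 0
    let S : Set (ℝ × (Fin n → ℝ)) := {z | 0 ≤ z.1 ∧ (∀ i, 0 ≤ z.2 i) ∧ z.1 + ∑ i, z.2 i ≤ c}
    have hS : {x : Fin (n + 1) → ℝ | (∀ i, 0 ≤ x i) ∧ ∑ i, x i ≤ c} =
        MeasurableEquiv.piFinSuccAbove (fun _ => ℝ) 0 ⁻¹' S := by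
      ext x
      simp [S, Fin.forall_fin_succ, Fin.sum_univ_succ, Fin.tail, and_assoc]
    have hSc : IsClosed S := by
      simp only [S, Set.ofPred_and, Set.ofPred_forall]
      refine IsClosed.inter ?_ (IsClosed.inter ?_ ?_)
      · exact isClosed_le continuous_const continuous_fst
      · exact isClosed_iInter fun i => isClosed_le continuous_const (by fun_prop)
      · exact isClosed_le (by fun_prop) continuous_const
    rw [hS, hp.measure_preimage_equiv]
    refine (Measure.prod_apply hSc.measurableSet).trans_le ?_
    have hsec : ∀ t, volume (Prod.mk t ⁻¹' S) ≤
        (Set.Icc 0 c).indicator (fun t => ENNReal.ofReal ((c - t) ^ n / n.factorial)) t := by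
      intro t
      by_cases ht : t ∈ Set.Icc 0 c
      · rw [Set.indicator_of_mem ht]
        refine le_trans (measure_mono ?_) (ih (sub_nonneg.2 ht.2))
        rintro y ⟨-, h2, h3⟩
        refine ⟨h2, ?_⟩
        simp only at h3
        linarith
      · rw [Set.indicator_of_notMem ht]
        have : Prod.mk t ⁻¹' S = ∅ := by
          refine Set.eq_empty_of_forall_notMem ?_
          rintro y ⟨h1, h2, h3⟩
          have := sum_nonneg fun i (_ : i ∈ univ) => h2 i
          simp only at h1 h3 this
          exact ht ⟨h1, by linarith⟩
        simp [this]
    refine (lintegral_mono hsec).trans ?_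
    rw [lintegral_indicator measurableSet_Icc, ← ofReal_integral_eq_lintegral_ofReal]
    · refine ENNReal.ofReal_le_ofReal (le_of_eq ?_)
      rw [integral_Icc_eq_integral_Ioc, ← intervalIntegral.integral_of_le hc,
        intervalIntegral.integral_div,
        intervalIntegral.integral_comp_sub_left (fun t => t ^ n) c, integral_pow]
      rw [Nat.factorial_succ]
      push_cast
      field_simp
      ring
    · exact Continuous.integrableOn_Icc (by fun_prop)
    · filter_upwards [ae_restrict_mem measurableSet_Icc] with t ht
      have := sub_nonneg.2 ht.2
      simp only [Pi.zero_apply]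
      positivity

/-- A total price below `n / (n + 1)` is too small for a volume of `1 / (n + 1)`. -/
theorem lowerVol_lt_of_le {n : ℕ} (hn : 2 ≤ n) {g : ℕ → ℝ} (h0 : 0 ≤ g n)
    (h : g n ≤ n / ((n : ℝ) + 1)) : lowerVol n g < 1 / ((n : ℝ) + 1) := by
  have hn0 : (0 : ℝ) < n := by exact_mod_cast (show 0 < n by omega)
  have h1 : lowerVol n g ≤ g n ^ n / n.factorial := by
    refine ENNReal.toReal_le_of_le_ofReal (by positivity)
      ((measure_mono ?_).trans (volume_simplex_le n h0))
    intro x hx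
    refine ⟨fun i => (hx.1 i).1, ?_⟩
    simpa using hx.2 univ
  refine h1.trans_lt ?_
  have hlt : (n : ℝ) / (n + 1) < 1 := by rw [div_lt_one (by positivity)]; linarith
  -- The exponent `n ≥ 2` makes this strict; dividing by `n ! ≥ n` then brings the simplex bound
  -- below `1 / (n + 1)`.
  have h2 : g n ^ n < n / ((n : ℝ) + 1) :=
    (pow_le_pow_left₀ h0 h n).trans_lt
      (by simpa using pow_lt_pow_right_of_lt_one₀ (by positivity) hlt (show 1 < n by omega))
  have h3 : (n : ℝ) ≤ n.factorial := by exact_mod_cast Nat.self_le_factorial n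
  rw [div_lt_iff₀ (by positivity)]
  refine h2.trans_le ?_
  rw [div_mul_eq_mul_div, one_mul]
  gcongr

/-! ### Solvability yields a symmetric solution. -/

theorem ConcaveUpTo.of_submodular {n : ℕ} {q : Finset (Fin n) → ℝ} {f : ℕ → ℝ}
    {I : Finset (Fin n)}
    (hq : ∀ J J' : Finset (Fin n), q (J ∪ J') + q (J ∩ J') ≤ q J + q J')
    (hf : ∀ J ⊆ I, q J = f #J) : ConcaveUpTo #I f := by
  intro j hj
  obtain ⟨T, hT, hTj⟩ := exists_subset_card_eq hj
  obtain ⟨a, ha, b, hb, hab⟩ := one_lt_card.1 (show 1 < #T by omega)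
  have h := hq (T.erase a) (T.erase b)
  have e1 : T.erase a ∪ T.erase b = T := by
    ext x
    simp only [mem_union, mem_erase]
    grind
  have e2 : T.erase a ∩ T.erase b = (T.erase a).erase b := by
    ext x
    simp only [mem_inter, mem_erase]
    tauto
  have hb' : b ∈ T.erase a := mem_erase.2 ⟨hab.symm, hb⟩
  have c1 := card_erase_add_one ha
  have c2 := card_erase_add_one hb
  have c3 := card_erase_add_one hb'
  rw [e1, e2, hf T hT, hf _ ((erase_subset _ _).trans hT), hf _ ((erase_subset _ _).trans hT),
    hf _ ((erase_subset _ _).trans ((erase_subset _ _).trans hT)), hTj,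
    show #(T.erase a) = j + 1 by omega, show #(T.erase b) = j + 1 by omega,
    show #((T.erase a).erase b) = j by omega] at h
  linarith

theorem emptyBody_eq {n : ℕ} {q : Finset (Fin n) → ℝ} {f : ℕ → ℝ} {I : Finset (Fin n)}
    (hf : ∀ J ⊆ I, q J = f #J) : emptyBody q I = lowerBody I f := by
  ext x
  refine and_congr Iff.rfl (forall_congr' fun J => ?_)
  rw [hf, card_map]
  intro i hi
  obtain ⟨j, -, rfl⟩ := mem_map.1 hi
  exact j.2

theorem one_sub_div_pos {m n : ℕ} (h : m ≤ n) : 0 < 1 - (m : ℝ) / ((n : ℝ) + 1) := by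
  have : (m : ℝ) ≤ n := by exact_mod_cast h
  rw [sub_pos, div_lt_one (by positivity)]
  linarith

/-- A symmetric solution of the volume equations. -/
structure IsSymmetricSolution (n : ℕ) (g : ℕ → ℝ) : Prop where
  zero : g 0 = 0
  concave : ConcaveUpTo n g
  vol : ∀ m ≤ n, lowerVol m g = 1 - (m : ℝ) / ((n : ℝ) + 1)

theorem pos_of_lowerVol_eq {n m : ℕ} {g : ℕ → ℝ}
    (hv : lowerVol m g = 1 - (m : ℝ) / ((n : ℝ) + 1)) (hm : 1 ≤ m) (hmn : m ≤ n) : 0 < g m := by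
  by_contra h
  have := lowerVol_eq_zero hm le_rfl (not_lt.1 h)
  have := one_sub_div_pos hmn
  linarith

theorem lt_one_of_lowerVol_eq {n : ℕ} {g : ℕ → ℝ} (h0 : g 0 = 0)
    (hv : lowerVol 1 g = 1 - (1 : ℝ) / ((n : ℝ) + 1)) : g 1 < 1 := by
  by_contra h
  have h1 : lowerVol 1 g = 1 := lowerVol_eq_one fun k hk => by
    interval_cases k
    · simp [h0]
    · simpa using h
  have : (0 : ℝ) < 1 / ((n : ℝ) + 1) := by positivity
  linarith

theorem le_lowerVol_one {g : ℕ → ℝ} (h0 : g 0 = 0) (h : 0 ≤ g 1) (h1 : g 1 ≤ 1) :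
    g 1 ≤ lowerVol 1 g := by
  have hv : volume.real (Set.univ.pi fun _ : Fin 1 => Set.Icc (0 : ℝ) (g 1)) = g 1 := by
    rw [measureReal_def, volume_pi_pi]
    simp [h]
  nth_rewrite 1 [← hv]
  refine measureReal_mono (fun x hx => ?_) (volume_ne_top_of_subset_cube fun _ hx => hx.1)
  have hx' : ∀ i, 0 ≤ x i ∧ x i ≤ g 1 := fun i => hx i trivial
  refine ⟨fun i => ⟨(hx' i).1, (hx' i).2.trans h1⟩, fun K => ?_⟩
  rcases K.eq_empty_or_nonempty with rfl | hK
  · simp [h0]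
  · have : K = {0} := by
      ext i
      obtain ⟨j, hj⟩ := hK
      rw [Subsingleton.elim i j, Subsingleton.elim j 0] at *
      simpa using hj
    simpa [this] using (hx' 0).2

/-- Symmetry is proved by induction on size. Once smaller prices depend only on size, the bodies of
two bundles of size `m + 1` differ only in their total bound, so equal volumes force equal prices.
-/
theorem exists_symmetricSolution {n : ℕ} (hn : 1 ≤ n) (h : Solvable (candidate (n - 1) n)) :
    ∃ g, IsSymmetricSolution n g := by
  obtain ⟨q, q0, -, hq⟩ := h
  replace hq : ∀ I : Finset (Fin n), _ := fun I => hq I (by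
    have h1 : #I ≤ n := card_finset_fin_le I
    by_cases h2 : #I = n
    · exact Or.inr ((card_eq_iff_eq_univ I).1 (by simpa using h2))
    · exact Or.inl (by omega))
  have hsub : ∀ J J' : Finset (Fin n), q (J ∪ J') + q (J ∩ J') ≤ q J + q J' :=
    fun J J' => (hq (J ∪ J')).2.1 J J' rfl
  have hvol : ∀ {f : ℕ → ℝ} {I : Finset (Fin n)}, (∀ J ⊆ I, q J = f #J) → ∀ J ⊆ I,
      lowerVol #J f = 1 - (#J : ℝ) / ((n : ℝ) + 1) := by
    intro f I hf J hJ
    rw [← (hq J).2.2, emptyBody_eq fun L hL => hf L (hL.trans hJ), volume_lowerBody,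
      Fintype.card_coe]
  have hsym : ∀ m ≤ n, ∃ g : ℕ → ℝ, ∀ J : Finset (Fin n), #J ≤ m → q J = g #J := by
    intro m
    induction m with
    | zero =>
      refine fun _ => ⟨fun _ => 0, fun J hJ => ?_⟩
      rw [card_eq_zero.1 (Nat.le_zero.1 hJ), q0]
    | succ m ih =>
      intro hmn
      obtain ⟨g, hg⟩ := ih (by omega)
      -- Below a fixed `I` of size `m + 1`, the only bundle of that size is `I` itself, so prices
      -- there already depend only on size.
      have hupd : ∀ I : Finset (Fin n), #I = m + 1 → ∀ J ⊆ I,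
          q J = Function.update g (m + 1) (q I) #J := by
        intro I hI J hJ
        by_cases hJm : #J = m + 1
        · rw [hJm, Function.update_self, eq_of_subset_of_card_le hJ (by omega)]
        · have := card_le_card hJ
          rw [Function.update_of_ne hJm, hg J (by omega)]
      have hnlt : ∀ I I' : Finset (Fin n), #I = m + 1 → #I' = m + 1 → ¬ q I < q I' := by
        intro I I' hI hI' hlt
        have hf := hupd I' hI'
        have hh := hupd I hI
        set f := Function.update g (m + 1) (q I') with hfdef
        set h := Function.update g (m + 1) (q I) with hhdef
        have vf := hvol hf I' subset_rfl
        have vh := hvol hh I subset_rfl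
        have f0 : f 0 = 0 := by rw [← q0]; exact (hf ∅ (empty_subset _)).symm
        obtain ⟨i, hi⟩ := card_pos.1 (show 0 < #I' by omega)
        have v1 := hvol hf {i} (singleton_subset_iff.2 hi)
        rw [card_singleton, Nat.cast_one] at v1
        have hconc := ConcaveUpTo.of_submodular hsub hf
        have fpos := pos_of_lowerVol_eq vf (by omega) (card_finset_fin_le _)
        rw [hI'] at hconc vf fpos
        rw [hI] at vh
        have := lowerVol_lt (h := h) hconc f0 (lt_one_of_lowerVol_eq f0 v1).le (by omega)
          (fun j _ => by
            by_cases hj : j = m + 1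
            · subst hj
              simpa [hfdef, hhdef] using hlt.le
            · simp [hfdef, hhdef, hj])
          (by simpa [hfdef, hhdef] using hlt) fpos
        linarith
      obtain ⟨I, -, hI⟩ := exists_subset_card_eq
        (show m + 1 ≤ #(univ : Finset (Fin n)) by simpa using hmn)
      refine ⟨Function.update g (m + 1) (q I), fun J hJ => ?_⟩
      by_cases hJm : #J = m + 1
      · rw [hJm, Function.update_self]
        exact le_antisymm (not_lt.1 (hnlt _ _ hI hJm)) (not_lt.1 (hnlt _ _ hJm hI))
      · rw [Function.update_of_ne hJm, hg J (by omega)]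
  obtain ⟨g, hg⟩ := hsym n le_rfl
  have hg' : ∀ J ⊆ (univ : Finset (Fin n)), q J = g #J := fun J _ => hg J (card_finset_fin_le _)
  refine ⟨g, ?_, ?_, fun m hm => ?_⟩
  · rw [← q0]; exact (hg' ∅ (empty_subset _)).symm
  · simpa using ConcaveUpTo.of_submodular hsub hg'
  · obtain ⟨J, hJ, rfl⟩ := exists_subset_card_eq
      (show m ≤ #(univ : Finset (Fin n)) by simpa using hm)
    exact hvol hg' J hJ

/-! ### From volume equations to a critical schedule. -/

/-- In `sum_symDeficiency` each intermediate term dies, either through its deficiency or because a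
nonpositive next increment flattens the lower body. The empty bundle has deficiency 1. -/
theorem lowerVol_add_symDeficiency (n : ℕ) {m : ℕ} (hm : 1 ≤ m) {f : ℕ → ℝ}
    (hf : ConcaveUpTo m f) (f0 : f 0 = 0)
    (h : ∀ j, 1 ≤ j → j < m → symDeficiency n f j = 0 ∨ f (j + 1) ≤ f j) :
    lowerVol m f + symDeficiency n f m = 1 - (m : ℝ) / ((n : ℝ) + 1) := by
  rw [← sum_symDeficiency n hf, sum_range_succ, ← sum_range_add_sum_Ico _ hm, sum_range_one,
    sum_eq_zero (s := Ico 1 m)]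
  · have e0 : symDeficiency n f 0 = 1 := by
      rw [symDeficiency, upperVol_zero (by simp)]
      simp
    have em : lowerVol (m - m) (fun k => f (m + k) - f m) = 1 := by
      refine lowerVol_eq_one fun k hk => ?_
      obtain rfl : k = 0 := by omega
      simp
    rw [em, e0]
    simp [f0]
  · intro j hj
    obtain ⟨h1, h2⟩ := mem_Ico.1 hj
    rcases h j h1 h2 with h3 | h3
    · rw [h3]; ring
    · rw [lowerVol_eq_zero (k := 1) le_rfl (by omega) (sub_nonpos.2 h3)]; ring

theorem regionVol_pos {n : ℕ} {f : ℕ → ℝ} (hf : ConcaveUpTo n f) (f0 : f 0 = 0) (f1 : f 1 < 1)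
    (hmono : ∀ i j, i ≤ j → j ≤ n → f i ≤ f j) (I : Finset (Fin n))
    (h : f #I < f (#I + 1) ∨ #I = n) : 0 < regionVol (fun J : Finset (Fin n) => f #J) I := by
  have hI : #I ≤ n := card_finset_fin_le _
  rw [regionVol_eq hf]
  refine mul_pos (upperVol_pos f1 fun k hk => ?_) ?_
  · have := hf.sub_le f0 (#I - k) k (by omega)
    rwa [Nat.sub_add_cancel hk] at this
  · rcases h with h | h
    · refine lowerVol_pos (sub_pos.2 h) (by simp) fun k hk hkn => ?_
      exact sub_le_sub_right (hmono _ _ (by omega) (by omega)) _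
    · rw [lowerVol_eq_one]
      · exact one_pos
      · intro k hk
        obtain rfl : k = 0 := by omega
        simp

theorem lt_succ_of_regionVol_pos {n : ℕ} {f : ℕ → ℝ} (hf : ConcaveUpTo n f)
    {I : Finset (Fin n)} (hI : #I < n)
    (h : 0 < regionVol (fun J : Finset (Fin n) => f #J) I) : f #I < f (#I + 1) := by
  by_contra hle
  rw [regionVol_eq hf,
    lowerVol_eq_zero (k := 1) le_rfl (by omega) (sub_nonpos.2 (not_lt.1 hle)), mul_zero] at h
  exact h.false

theorem ConcaveUpTo.monotone {n : ℕ} {f : ℕ → ℝ} (hf : ConcaveUpTo n f)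
    (h : ∀ j ≤ n, f j ≤ f n) : ∀ i j, i ≤ j → j ≤ n → f i ≤ f j := by
  intro i j hij
  induction j, hij using Nat.le_induction with
  | base => exact fun _ => le_rfl
  | succ j hij ih =>
    intro hj
    have h1 := ih (by omega)
    have h2 := hf.add_le j 1 (n - (j + 1)) (by omega)
    have h3 := h (j + (n - (j + 1))) (by omega)
    rw [show j + 1 + (n - (j + 1)) = n by omega] at h2
    linarith

theorem card_lt_of_ne_univ {n : ℕ} {I : Finset (Fin n)} (h : I ≠ univ) : #I < n := by
  simpa using (card_lt_iff_ne_univ I).2 h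

/-- Truncating a symmetric solution at the price of the full bundle gives a critical schedule. -/
theorem IsSymmetricSolution.exists_critical {n : ℕ} {g : ℕ → ℝ} (hn : 1 ≤ n)
    (hg : IsSymmetricSolution n g) :
    ∃ k, 1 ≤ k ∧ k ≤ n ∧ (∀ j, k < j → j ≤ n → g n ≤ g j) ∧
      ∃ p : Finset (Fin n) → ℝ, IsSymmetricCritical k p := by
  classical
  have hpos := pos_of_lowerVol_eq (hg.vol n le_rfl) hn le_rfl
  have g1 : g 1 < 1 := lt_one_of_lowerVol_eq hg.zero (by simpa using hg.vol 1 hn)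
  -- The last size not affected by truncation at `g n`.
  let k₀ := Nat.findGreatest (fun j => g j < g n) (n - 1)
  have hk : g k₀ < g n := Nat.findGreatest_spec (P := fun j => g j < g n) (Nat.zero_le _)
    (by rw [hg.zero]; exact hpos)
  have hkn : k₀ ≤ n - 1 := Nat.findGreatest_le _
  have hgt : ∀ j, k₀ < j → j ≤ n → g n ≤ g j := by
    intro j hj hjn
    rcases eq_or_lt_of_le hjn with rfl | hlt
    · exact le_rfl
    · exact not_lt.1 (Nat.findGreatest_is_greatest hj (by omega))
  let f : ℕ → ℝ := fun k => min (g k) (g n)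
  have hf : ConcaveUpTo n f := hg.concave.min_const _
  have f0 : f 0 = 0 := by simp only [f, hg.zero]; exact min_eq_left hpos.le
  have f1 : f 1 < 1 := (min_le_left _ _).trans_lt g1
  have fn : f n = g n := min_self _
  have hmono := hf.monotone fun j _ => by rw [fn]; exact min_le_right _ _
  have hfgt : ∀ j, k₀ < j → j ≤ n → f j = g n := fun j h1 h2 => min_eq_right (hgt j h1 h2)
  have hfle : ∀ j, j ≤ k₀ → f j = g j := by
    intro j hj
    have h1 := hmono j k₀ hj (by omega)
    have h2 : f k₀ < g n := (min_le_left _ _).trans_lt hk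
    rcases min_choice (g j) (g n) with h3 | h3
    · exact h3
    · have h4 : f j = g n := h3
      linarith
  have hlt : ∀ j, j ≤ k₀ → f j < f (j + 1) := by
    intro j hj
    have h1 := hf.diff_le hj (by omega)
    rw [hfgt (k₀ + 1) (by omega) (by omega), hfle k₀ le_rfl] at h1
    linarith
  have hdef : ∀ m, 1 ≤ m → m ≤ k₀ → symDeficiency n f m = 0 := by
    intro m
    induction m using Nat.strong_induction_on with
    | _ m ih =>
      intro h1 h2
      have h3 := lowerVol_add_symDeficiency n h1 (hf.mono (by omega)) f0
        fun j hj hjm => Or.inl (ih j hjm hj (by omega))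
      rw [lowerVol_congr fun j hj => hfle j (by omega), hg.vol m (by omega)] at h3
      linarith
  have hdefn : symDeficiency n f n = 0 := by
    have h3 := lowerVol_add_symDeficiency n hn hf f0 fun j hj hjn => by
      rcases le_or_gt j k₀ with h | h
      · exact Or.inl (hdef j hj h)
      · exact Or.inr (by rw [hfgt j h hjn.le, hfgt (j + 1) (by omega) hjn])
    -- Coordinates are nonnegative, so the bound `g n` on the total sum already bounds all partial
    -- sums: truncation leaves the body unchanged.
    have h4 : lowerVol n f = lowerVol n g := by
      unfold lowerVol
      congr 1
      ext x
      refine and_congr_right fun hx => ⟨fun h K => (h K).trans (min_le_left _ _), fun h K =>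
        le_min (h K) ?_⟩
      refine (sum_le_sum_of_subset_of_nonneg (subset_univ K) fun i _ _ => (hx i).1).trans ?_
      simpa using h univ
    rw [h4, hg.vol n le_rfl] at h3
    linarith
  have hposiff : ∀ I : Finset (Fin n),
      0 < regionVol (fun J : Finset (Fin n) => f #J) I ↔ I ∈ candidate k₀ n := by
    intro I
    constructor
    · intro h
      by_cases hI : I = univ
      · exact Or.inr hI
      · have hIn := card_lt_of_ne_univ hI
        refine Or.inl (not_lt.1 fun hkI => ?_)
        have := lt_succ_of_regionVol_pos hf hIn h
        rw [hfgt _ hkI hIn.le, hfgt _ (by omega) hIn] at this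
        exact this.false
    · rintro (h | h)
      · exact regionVol_pos hf f0 f1 hmono I (Or.inl (hlt _ h))
      · exact regionVol_pos hf f0 f1 hmono I (Or.inr (by simp [h]))
  have hcrit : IsSymmetricCritical k₀ (fun J : Finset (Fin n) => f #J) := by
    refine ⟨by simpa [IsPriceSchedule] using f0, fun I hI h0 => ?_, hf.submodular,
      fun I _ J _ h => congrArg f h, hposiff, fun I hI hne => ?_⟩
    · have hIk : k₀ < #I := by
        by_contra h
        exact ((hposiff I).2 (Or.inl (not_lt.1 h))).ne' h0
      have e : ∀ J : Finset (Fin n), I ⊆ J → f #J = g n := fun J hJ =>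
        hfgt _ (hIk.trans_le (card_le_card hJ)) (card_finset_fin_le _)
      refine ⟨⟨univ, ssubset_univ_iff.2 hI, ?_⟩, ?_⟩
      · simp only [e I subset_rfl, e univ (subset_univ _)]
      · rintro _ ⟨J, hJ, rfl⟩
        have hJ' : I ⊂ J := hJ
        simp only [e I subset_rfl, e J hJ'.subset, le_refl]
    · rw [deficiency_eq hf f0 f1.le hmono]
      rcases hI with h | h
      · exact hdef _ (card_pos.2 (nonempty_iff_ne_empty.2 hne)) h
      · simpa [h] using hdefn
  -- For `n = 1` the threshold `k₀` is 0, outside the admissible range, but parameters 0 and 1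
  -- describe the same candidate.
  rcases eq_or_lt_of_le hn with rfl | hn2
  · have hc : candidate k₀ 1 = candidate 1 1 := by
      ext I
      have h1 : #I ≤ 1 := card_finset_fin_le I
      refine ⟨fun _ => Or.inl h1, fun _ => ?_⟩
      by_cases h2 : I = univ
      · exact Or.inr h2
      · have := card_lt_of_ne_univ h2
        exact Or.inl (by omega)
    exact ⟨1, le_rfl, le_rfl, fun j h1 h2 => by omega, _, hcrit.schedule, hcrit.normalized,
      hcrit.submodular, hc ▸ hcrit.symmetric, hc ▸ hcrit.critical⟩
  -- If `k₀ = 0`, then `g n ≤ g 1 ≤ n / (n + 1)`, too small a total price for the volume equation of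
  -- size `n`.
  · refine ⟨k₀, Nat.one_le_iff_ne_zero.2 fun h0 => ?_, by omega, hgt, _, hcrit⟩
    have h1 := hgt 1 (by omega) hn
    have h2 := le_lowerVol_one hg.zero (hpos.le.trans h1) g1.le
    have h3 : lowerVol 1 g = n / ((n : ℝ) + 1) := by
      rw [hg.vol 1 hn]
      field_simp
      push_cast
      ring
    have h4 := lowerVol_lt_of_le hn2 hpos.le (by linarith)
    have h5 := hg.vol n le_rfl
    have h6 : 1 - (n : ℝ) / ((n : ℝ) + 1) = 1 / ((n : ℝ) + 1) := by
      field_simp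
      ring
    linarith

/-! ### Comparing an arbitrary critical schedule with the symmetric solution. -/

/-- Two concave solutions of the volume equations of sizes up to `k` agree up to `k`. -/
theorem IsSymmetricSolution.eq_of_lowerVol_eq {n k : ℕ} {f g : ℕ → ℝ}
    (hg : IsSymmetricSolution n g) (hk : k ≤ n) (hf : ConcaveUpTo n f) (f0 : f 0 = 0)
    (f1 : f 1 ≤ 1)
    (hv : ∀ m, 1 ≤ m → m ≤ k → lowerVol m f = 1 - (m : ℝ) / ((n : ℝ) + 1)) :
    ∀ m ≤ k, f m = g m := by
  intro m
  induction m using Nat.strong_induction_on with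
  | _ m ih =>
    intro hm
    rcases Nat.eq_zero_or_pos m with rfl | hm0
    · rw [f0, hg.zero]
    have hvf := hv m hm0 hm
    have hvg := hg.vol m (by omega)
    have g1 : g 1 < 1 :=
      lt_one_of_lowerVol_eq hg.zero (by simpa using hg.vol 1 (by omega))
    rcases lt_trichotomy (f m) (g m) with h | h | h
    · have := lowerVol_lt (h := f) (hg.concave.mono (by omega)) hg.zero g1.le hm0
        (fun j hj => by
          rcases eq_or_lt_of_le hj with rfl | hj
          · exact h.le
          · exact (ih j hj (by omega)).le) h (pos_of_lowerVol_eq hvg hm0 (by omega))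
      linarith
    · exact h
    · have := lowerVol_lt (h := g) (hf.mono (by omega)) f0 f1 hm0
        (fun j hj => by
          rcases eq_or_lt_of_le hj with rfl | hj
          · exact h.le
          · exact (ih j hj (by omega)).ge) h (pos_of_lowerVol_eq hvf hm0 (by omega))
      linarith

/-- Such a bundle, unless full, has a null region, so normalization gives it the price of a larger
bundle; induct upwards. -/
theorem IsSymmetricCritical.eq_univ_of_lt {n k : ℕ} {p : Finset (Fin n) → ℝ}
    (hp : IsSymmetricCritical k p) (I : Finset (Fin n)) (hI : k < #I) : p I = p univ := by
  induction hd : n - #I using Nat.strong_induction_on generalizing I with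
  | _ d ih =>
    by_cases hIu : I = univ
    · rw [hIu]
    have hIn := card_lt_of_ne_univ hIu
    have h0 : regionVol p I = 0 := by
      refine le_antisymm (not_lt.1 fun h => ?_) measureReal_nonneg
      rcases (hp.critical.1 I).1 h with h | h
      · omega
      · exact hIu h
    obtain ⟨J, hJ, hJI⟩ := (hp.normalized I hIu h0).1
    have hcard : #I < #J := card_lt_card hJ
    rw [← hJI, ih (n - #J) (by omega) J (by omega) rfl]

theorem IsSymmetricCritical.exists_card {n k : ℕ} {p : Finset (Fin n) → ℝ}
    (hp : IsSymmetricCritical k p) : ∃ f : ℕ → ℝ, p = fun I : Finset (Fin n) => f #I := by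
  refine (Function.factorsThrough_iff p).1 fun I J hIJ => ?_
  have hIJ' : #I = #J := hIJ
  by_cases h : #I ≤ k
  · exact hp.symmetric I (Or.inl h) J (Or.inl (hIJ' ▸ h)) hIJ'
  · rw [hp.eq_univ_of_lt I (by omega), hp.eq_univ_of_lt J (by omega)]

/-- Exchange one item of `I` for one outside. The intersection still has more than `k` items, so all
four bundles carry the full price. -/
theorem IsSymmetricCritical.rightTight {n k : ℕ} {p : Finset (Fin n) → ℝ}
    (hp : IsSymmetricCritical k p) {I : Finset (Fin n)} (hI : I ≠ univ) (hk : k + 2 ≤ #I) :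
    RightTight p I := by
  obtain ⟨a, ha⟩ := card_pos.1 (show 0 < #I by omega)
  obtain ⟨b, hb⟩ : ∃ b, b ∉ I := not_forall.1 fun h => hI (eq_univ_iff_forall.2 h)
  have hba : b ≠ a := fun h => hb (h ▸ ha)
  have h1 := card_erase_add_one ha
  have h2 : #(insert b (I.erase a)) = #(I.erase a) + 1 :=
    card_insert_of_notMem fun h => hb (mem_of_mem_erase h)
  have h3 : I ∩ insert b (I.erase a) = I.erase a := by
    ext x
    simp only [mem_inter, mem_insert, mem_erase]
    grind
  refine ⟨insert b (I.erase a), fun h => ?_, fun h => hb (h (mem_insert_self _ _)), ?_⟩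
  · rcases mem_insert.1 (h ha) with h | h
    · exact hba h.symm
    · exact notMem_erase _ _ h
  · rw [h3, hp.eq_univ_of_lt I (by omega), hp.eq_univ_of_lt (I.erase a) (by omega),
      hp.eq_univ_of_lt (insert b (I.erase a)) (by omega),
      hp.eq_univ_of_lt (I ∪ _) (by have := card_le_card (subset_union_left (s₁ := I)
        (s₂ := insert b (I.erase a))); omega)]

/-- The prices equal `g` up to size `k`, and at size `k + 1` they are `f n ≤ g n ≤ g (k + 1)`. So
the lower volume at `k + 1` does not exceed its target, and the deficiency makes up the difference.
-/
theorem IsSymmetricCritical.deficiency_nonneg {n k : ℕ} {p : Finset (Fin n) → ℝ} {g : ℕ → ℝ}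
    (hp : IsSymmetricCritical k p) (hk1 : 1 ≤ k) (hg : IsSymmetricSolution n g)
    (hgk : ∀ j, k < j → j ≤ n → g n ≤ g j) {I : Finset (Fin n)} (hI : I ≠ univ)
    (hIk : #I = k + 1) : 0 ≤ deficiency p I := by
  have hIn := card_lt_of_ne_univ hI
  have hex : ∀ j ≤ n, ∃ J : Finset (Fin n), #J = j := fun j hj => by
    obtain ⟨J, -, hJ⟩ := exists_subset_card_eq
      (show j ≤ #(univ : Finset (Fin n)) by simpa using hj)
    exact ⟨J, hJ⟩
  obtain ⟨f, rfl⟩ := hp.exists_card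
  have hf : ConcaveUpTo n f := by
    simpa using ConcaveUpTo.of_submodular (q := fun I : Finset (Fin n) => f #I) (I := univ)
      hp.submodular fun J _ => rfl
  have f0 : f 0 = 0 := by simpa [IsPriceSchedule] using hp.schedule
  have hconst : ∀ j, k < j → j ≤ n → f j = f n := by
    intro j hj hjn
    obtain ⟨J, rfl⟩ := hex j hjn
    simpa using hp.eq_univ_of_lt J hj
  have hlt : ∀ j ≤ k, f j < f (j + 1) := by
    intro j hj
    obtain ⟨J, rfl⟩ := hex j (by omega)
    exact lt_succ_of_regionVol_pos hf (by omega) ((hp.critical.1 J).2 (Or.inl hj))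
  have hmono : ∀ i j, i ≤ j → j ≤ n → f i ≤ f j := by
    intro i j hij
    induction j, hij using Nat.le_induction with
    | base => exact fun _ => le_rfl
    | succ j hij ih =>
      intro hj
      refine (ih (by omega)).trans ?_
      rcases le_or_gt j k with h | h
      · exact (hlt j h).le
      · rw [hconst j h (by omega), hconst (j + 1) (by omega) hj]
  have f1 : f 1 < 1 := by
    obtain ⟨J, hJ⟩ := hex 1 (by omega)
    have h := (hp.critical.1 J).2 (Or.inl (by omega))
    by_contra h1
    rw [regionVol_eq hf, hJ, upperVol_one_eq_zero (by simpa [f0] using h1), zero_mul] at h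
    exact h.false
  have hdef : ∀ j, 1 ≤ j → j ≤ k → symDeficiency n f j = 0 := by
    intro j h1 hj
    obtain ⟨J, rfl⟩ := hex j (by omega)
    rw [← deficiency_eq hf f0 f1.le hmono]
    exact hp.critical.2 J (Or.inl hj) (nonempty_iff_ne_empty.1 (card_pos.1 h1))
  have hdefn : symDeficiency n f n = 0 := by
    have := hp.critical.2 univ (Or.inr rfl) (nonempty_iff_ne_empty.1 (card_pos.1 (by
      rw [card_univ, Fintype.card_fin]; omega)))
    rw [deficiency_eq hf f0 f1.le hmono] at this
    simpa using this
  have hvol : ∀ m, 1 ≤ m → m ≤ k → lowerVol m f = 1 - (m : ℝ) / ((n : ℝ) + 1) := by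
    intro m h1 h2
    have := lowerVol_add_symDeficiency n h1 (hf.mono (by omega)) f0
      fun j hj hjm => Or.inl (hdef j hj (by omega))
    rwa [hdef m h1 h2, add_zero] at this
  have hvoln : lowerVol n f = 1 - (n : ℝ) / ((n : ℝ) + 1) := by
    have := lowerVol_add_symDeficiency n (by omega) hf f0 fun j hj hjn => by
      rcases le_or_gt j k with h | h
      · exact Or.inl (hdef j hj h)
      · exact Or.inr (by rw [hconst j h hjn.le, hconst (j + 1) (by omega) hjn])
    rwa [hdefn, add_zero] at this
  have heq := hg.eq_of_lowerVol_eq (show k ≤ n by omega) hf f0 f1.le hvol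
  -- Otherwise `g` truncated at `g n` lies below `f` with a smaller total price, hence has strictly
  -- smaller volume; yet truncation keeps the volume of `g`, which equals that of `f`.
  have hfn : f n ≤ g n := by
    by_contra hcon
    rw [not_le] at hcon
    have h1 := lowerVol_lt (h := fun j => min (g j) (g n)) hf f0 f1.le (by omega)
      (fun j hj => by
        rcases le_or_gt j k with h | h
        · rw [heq j h]; exact min_le_left _ _
        · rw [hconst j h hj]; exact (min_le_right _ _).trans hcon.le)
      (by simpa using hcon) (pos_of_lowerVol_eq hvoln (by omega) le_rfl)
    have h2 : lowerVol n g ≤ lowerVol n (fun j => min (g j) (g n)) := by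
      refine measureReal_mono (fun x hx => ⟨hx.1, fun K => le_min (hx.2 K) ?_⟩)
        (volume_ne_top_of_subset_cube fun _ hx => hx.1)
      refine (sum_le_sum_of_subset_of_nonneg (subset_univ K) fun i _ _ => (hx.1 i).1).trans ?_
      simpa using hx.2 univ
    rw [hg.vol n le_rfl] at h2
    linarith
  have hle : lowerVol (k + 1) f ≤ lowerVol (k + 1) g := lowerVol_mono fun j hj => by
    rcases le_or_gt j k with h | h
    · exact (heq j h).le
    · rw [hconst j h (by omega)]
      exact hfn.trans (hgk j h (by omega))
  have hsum := lowerVol_add_symDeficiency n (by omega) (hf.mono (show k + 1 ≤ n by omega)) f0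
    fun j hj hjk => Or.inl (hdef j hj (by omega))
  rw [hg.vol (k + 1) (by omega)] at hle
  rw [deficiency_eq hf f0 f1.le hmono, hIk]
  linarith

end Auction

/-! ### Assembly of the proposition. -/

theorem mainTheorem11 (n : ℕ) (hn : 1 ≤ n)
    (hsolv : Auction.Solvable (Auction.candidate (n - 1) n)) :
    (∃ p : Finset (Fin n) → ℝ, Auction.IsSJA p) ∧
      ∀ p : Finset (Fin n) → ℝ, Auction.IsSJA p →
        ∀ I : Finset (Fin n), I ≠ ∅ → Auction.CriticalPointConditions p I := by
  obtain ⟨g, hg⟩ := Auction.exists_symmetricSolution hn hsolv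
  obtain ⟨k₁, hk1, hkn, hgk, p₁, hp₁⟩ := hg.exists_critical hn
  refine ⟨?_, ?_⟩
  · let S := {m : ℕ | m ∈ Set.Icc 1 n ∧
      ∃ p' : Finset (Fin n) → ℝ, Auction.IsSymmetricCritical m p'}
    have hne : S.Nonempty := ⟨k₁, ⟨hk1, hkn⟩, p₁, hp₁⟩
    have hb : BddAbove S := ⟨n, fun m hm => hm.1.2⟩
    have hmem := Nat.sSup_mem hne hb
    obtain ⟨p, hp⟩ := hmem.2
    exact ⟨p, sSup S, ⟨hmem, fun m hm => le_csSup hb hm⟩, hp⟩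
  · rintro p ⟨k, hk, hp⟩ I hI
    -- Maximality of `k` enters only here: it ensures `g n ≤ g j` for all sizes `j` beyond `k`.
    have hle : k₁ ≤ k := hk.2 ⟨⟨hk1, hkn⟩, p₁, hp₁⟩
    by_cases hIc : I ∈ Auction.candidate k n
    · have h0 := hp.critical.2 I hIc hI
      have hpos := (hp.critical.1 I).2 hIc
      exact ⟨fun _ _ => h0, fun _ _ => h0.ge, fun _ _ => h0.ge, fun _ _ _ => h0.le⟩
    · have hnpos : ¬ 0 < Auction.regionVol p I := fun h => hIc ((hp.critical.1 I).1 h)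
      have hIu : I ≠ Finset.univ := fun h => hIc (Or.inr h)
      have hIk : k < I.card := not_le.1 fun h => hIc (Or.inl h)
      have key : ¬ Auction.RightTight p I → 0 ≤ Auction.deficiency p I := by
        intro hr
        have : I.card = k + 1 := by
          by_contra h
          exact hr (hp.rightTight hIu (by omega))
        exact hp.deficiency_nonneg (hk1.trans hle) hg
          (fun j hj hjn => hgk j (hle.trans_lt hj) hjn) hIu this
      exact ⟨fun _ h => absurd h hnpos, fun ht _ => key fun h => ht (Or.inr h), fun _ => key,
        fun _ _ h => absurd h hnpos⟩
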